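/- Setting. Order the quadratures of $n$ modes in pairs $(q_i,p_i)$, let $\Omega_n=I_n\otimes\begin{pmatrix}0&1\\-1&0\end{pmatrix}$, and let $\mathrm{Sp}(2n,\mathbb R)$ be the group of real matrices $S$ with $S\Omega_nS^\top=\Omega_n$. A GKP-stabilizer code with $N$ data modes and $M$ ancilla modes consists of an encoding $S_{\rm enc}\in\mathrm{Sp}(2(N+M),\mathbb R)$, an ancillary lattice $\mathcal L\subset\mathbb R^{2M}$ given by an invertible generator matrix $\mathbf M$ which is symplectically integral, i.e. $\mathbf M^\top\Omega_M\mathbf M=2\pi A$ with $A$ an integer matrix, and a measurable estimator $f:\mathbb R^{2M}\to\mathbb R^{2N}$. The lattice is canonical if $|\det\mathbf M|=(2\pi)^M$. Under iid additive Gaussian noise of variance $\sigma^2\ge 0$, a random displacement $\xi\sim\mathcal N(0,\sigma^2I_{2(N+M)})$ acts between $S_{\rm enc}$ and $S_{\rm enc}^{-1}$, so that the data and the ancilla suffer the displacements $(x_d,x_a)=S_{\rm enc}^{-1}\xi$. The syndrome is $s=\ell^{-1}\mathbf M^\top\Omega_Mx_a$ reduced componentwise modulo $\ell=\sqrt{2\pi}$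 to $[-\ell/2,\ell/2)$. The residual displacement of the data is $\xi_d=x_d-f(s)$, the output noise matrix $V_{\rm out}$ is its covariance matrix (or its matrix $\mathbb E[\xi_d\xi_d^\top]$ of uncentred second moments; the theorem holds for either choice), and the geometric-mean error is $\bar\sigma_{\rm GM}^2=\det(V_{\rm out})^{1/2N}$. For gains $G_i\ge1$, $1\le i\le\min(N,M)$, let $T_G$ be the direct product of the two-mode squeezing (TMS) operations $\begin{pmatrix}\sqrt{G_i}\,I&\sqrt{G_i-1}\,Z\\\sqrt{G_i-1}\,Z&\sqrt{G_i}\,I\end{pmatrix}$, $Z=\mathrm{diag}(1,-1)$, between data mode $i$ and ancilla mode $i$, and of the identity on the remaining modes. A code with encoding $T_G$ and ancillary lattice $\mathcal L$ is a direct product of TMS codes with ancillary lattice $\mathcal L$, written $\mathsf{TMS}^\otimes(\mathcal L)$. Theorem (Sufficiency of $\mathsf{TMS}^\otimes(\mathcal L)$). For every $S_{\rm enc}\in\mathrm{Sp}(2(N+M),\mathbb R)$ there are gains $G_i\ge1$ and local symplectic matrices $\Lambda_d\in\mathrm{Sp}(2N,\mathbb R)$ and $\Lambda_a\in\mathrm{Sp}(2M,\mathbb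 R)$, depending only on $S_{\rm enc}$, such that $T_G$ is symplectic and the following hold. 1. For every $\sigma$, the vectors $(\Lambda_d\oplus\Lambda_a)S_{\rm enc}^{-1}\xi$ and $T_G^{-1}\xi$ have the same distribution. 2. For every symplectically integral lattice $\mathcal L$ with generator matrix $\mathbf M$, the set $\mathcal L'=\Lambda_a\mathcal L$ is a symplectically integral lattice with generator matrix $\Lambda_a\mathbf M$, and it is canonical if and only if $\mathcal L$ is. 3. For every such $\mathcal L$, every $\sigma$ and every measurable $f$, the residual displacement of the code $\mathsf{TMS}^\otimes(\mathcal L')$ with the estimator $f'=\Lambda_d f$ has the same distribution as $\Lambda_d\xi_d$, where $\xi_d$ is the residual displacement of the code $(S_{\rm enc},\mathcal L,f)$. If $\xi_d$ has finite second moments, then so has the residual displacement of the TMS code, and the two output noise matrices satisfy $V_{\rm out}'=\Lambda_dV_{\rm out}\Lambda_d^\top$; hence the two codes have the same geometric-mean error. -/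

import Mathlib

open MeasureTheory ProbabilityTheory
open scoped Matrix NNReal

namespace GKP

/-- Quadrature labels of a set of modes `ι`: `Sum.inl i` is the position quadrature `q i`,
`Sum.inr i` is the momentum quadrature `p i`. -/
abbrev Quad (ι : Type) : Type := ι ⊕ ι

/-- The real phase space of the modes `ι`. -/
abbrev Phase (ι : Type) : Type := Quad ι → ℝ

/-- The symplectic form, with `Ω (q i) (p i) = 1` and `Ω (p i) (q i) = -1`
(Mathlib's `Matrix.J` has the opposite sign; both define the same symplectic group). -/
def Omega (ι : Type) [DecidableEq ι] : Matrix (Quad ι) (Quad ι) ℝ :=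
  Matrix.fromBlocks 0 1 (-1) 0

/-- The real symplectic group of the modes `ι`. -/
abbrev Sp (ι : Type) [DecidableEq ι] [Fintype ι] : Submonoid (Matrix (Quad ι) (Quad ι) ℝ) :=
  Matrix.symplecticGroup ι ℝ

/-- The local transformation acting as `A` on the modes `α` and as `B` on the modes `β`. -/
def localSum {α β : Type} (A : Matrix (Quad α) (Quad α) ℝ) (B : Matrix (Quad β) (Quad β) ℝ) :
    Matrix (Quad (α ⊕ β)) (Quad (α ⊕ β)) ℝ :=
  (Matrix.fromBlocks A 0 0 B).reindex
    (Equiv.sumSumSumComm α α β β) (Equiv.sumSumSumComm α α β β)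

/-- The part of a phase-space vector that lives on the modes `α` (the data). -/
def dataPart {α β : Type} (x : Phase (α ⊕ β)) : Phase α :=
  Sum.elim (fun i => x (Sum.inl (Sum.inl i))) (fun i => x (Sum.inr (Sum.inl i)))

/-- The part of a phase-space vector that lives on the modes `β` (the ancilla). -/
def ancillaPart {α β : Type} (x : Phase (α ⊕ β)) : Phase β :=
  Sum.elim (fun j => x (Sum.inl (Sum.inr j))) (fun j => x (Sum.inr (Sum.inr j)))

/-! ### Products of two-mode squeezing operations -/

section TMS

variable {N M : ℕ}

/-- The gain at the `k`-th data-ancilla pair; modes without a partner have gain `1`. -/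
noncomputable def gainAt (G : Fin (min N M) → ℝ) (k : ℕ) : ℝ :=
  if h : k < min N M then G ⟨k, h⟩ else 1

/-- The `N × M` matrix coupling data mode `i` to ancilla mode `i` with strength `√(G i - 1)`. -/
noncomputable def tmsCoupling (G : Fin (min N M) → ℝ) : Matrix (Fin N) (Fin M) ℝ :=
  Matrix.of fun i j => if (i : ℕ) = (j : ℕ) then √(gainAt G i - 1) else 0

/-- Action of the product of two-mode squeezers on the quadratures of one kind. The sign is
`1` for positions and `-1` for momenta. -/
noncomputable def tmsQuad (sign : ℝ) (G : Fin (min N M) → ℝ) :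
    Matrix (Fin N ⊕ Fin M) (Fin N ⊕ Fin M) ℝ :=
  Matrix.fromBlocks
    (Matrix.diagonal fun i => √(gainAt G i)) (sign • tmsCoupling G)
    (sign • (tmsCoupling G)ᵀ) (Matrix.diagonal fun j => √(gainAt G j))

/-- The direct product of two-mode squeezing operations
`[[√G I, √(G-1) Z], [√(G-1) Z, √G I]]`, one for each pair (data mode `i`, ancilla mode `i`),
and the identity on all the remaining modes. Here `Z = diag(1, -1)`. -/
noncomputable def tmsMatrix (G : Fin (min N M) → ℝ) :
    Matrix (Quad (Fin N ⊕ Fin M)) (Quad (Fin N ⊕ Fin M)) ℝ :=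
  Matrix.fromBlocks (tmsQuad 1 G) 0 0 (tmsQuad (-1) G)

end TMS

/-! ### GKP lattices -/

/-- A symplectically integral lattice of full rank in the phase space of `M` modes, given by a
basis (the columns of the generator matrix): the symplectic products of the basis vectors are
integer multiples of `2π`. -/
structure Lattice (M : ℕ) where
  /-- the generator matrix; its columns are the basis vectors -/
  gen : Matrix (Quad (Fin M)) (Quad (Fin M)) ℝ
  isUnit_det : IsUnit gen.det
  integral : ∃ A : Matrix (Quad (Fin M)) (Quad (Fin M)) ℤ,
    genᵀ * Omega (Fin M) * gen = (2 * Real.pi) • A.map (fun n : ℤ => (n : ℝ))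

/-- The points of the lattice. -/
def Lattice.points {M : ℕ} (L : Lattice M) : Submodule ℤ (Phase (Fin M)) :=
  Submodule.span ℤ (Set.range L.gen.col)

/-- Canonical lattices: the stabilized code space is one-dimensional. -/
def Lattice.IsCanonical {M : ℕ} (L : Lattice M) : Prop :=
  |L.gen.det| = (2 * Real.pi) ^ M

/-- Reduction of a real number modulo `ℓ = √(2π)` to the interval `[-ℓ/2, ℓ/2)`. -/
noncomputable def modEll (t : ℝ) : ℝ :=
  t - √(2 * Real.pi) * (round (t / √(2 * Real.pi)) : ℝ)

/-- The syndrome of a displacement error `e` of the lattice state: measuring the stabilizer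
given by the basis vector `λ` reveals `λᵀ Ω e` modulo `2π`, reported in units of `ℓ = √(2π)`. -/
noncomputable def Lattice.syndrome {M : ℕ} (L : Lattice M) (e : Phase (Fin M)) : Phase (Fin M) :=
  fun k => modEll ((√(2 * Real.pi))⁻¹ * (L.genᵀ *ᵥ (Omega (Fin M) *ᵥ e)) k)

/-! ### Noise, decoding and residual error -/

section Code

variable {N M : ℕ}

/-- The iid additive Gaussian noise on `N` data and `M` ancilla modes: a random displacement all
of whose components are independent and centred with variance `σ²`. -/
noncomputable def agn (N M : ℕ) (σ : ℝ≥0) : Measure (Phase (Fin N ⊕ Fin M)) :=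
  Measure.pi fun _ => gaussianReal 0 (σ ^ 2)

/-- The displacement left after the encoding `S`, the noise displacement `ξ` and the inverse
encoding: `U_S⁻¹ D_ξ U_S` is the displacement by `S⁻¹ ξ`. -/
noncomputable def decoded (S : Sp (Fin N ⊕ Fin M)) (ξ : Phase (Fin N ⊕ Fin M)) :
    Phase (Fin N ⊕ Fin M) :=
  (S : Matrix (Quad (Fin N ⊕ Fin M)) (Quad (Fin N ⊕ Fin M)) ℝ)⁻¹ *ᵥ ξ

/-- The law of the correlated noise `S⁻¹ ξ`. -/
noncomputable def decodedNoise (S : Sp (Fin N ⊕ Fin M)) (σ : ℝ≥0) :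
    Measure (Phase (Fin N ⊕ Fin M)) :=
  (agn N M σ).map (decoded S)

/-- The residual displacement of the data after the corrective displacement: the error of the
estimator `f`, evaluated at the syndrome of the ancilla error, in guessing the data error. -/
noncomputable def residual (S : Sp (Fin N ⊕ Fin M)) (L : Lattice M)
    (f : Phase (Fin M) → Phase (Fin N)) (ξ : Phase (Fin N ⊕ Fin M)) : Phase (Fin N) :=
  dataPart (decoded S ξ) - f (L.syndrome (ancillaPart (decoded S ξ)))

/-- The law of the residual displacement of the data. -/
noncomputable def residualLaw (S : Sp (Fin N ⊕ Fin M)) (L : Lattice M) (σ : ℝ≥0)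
    (f : Phase (Fin M) → Phase (Fin N)) : Measure (Phase (Fin N)) :=
  (agn N M σ).map (residual S L f)

/-- All second moments of a random displacement are finite. -/
def FiniteVariance (μ : Measure (Phase (Fin N))) : Prop :=
  ∀ i, MemLp (fun x : Phase (Fin N) => x i) 2 μ

/-- The covariance matrix of a random displacement. -/
noncomputable def covMatrix (μ : Measure (Phase (Fin N))) :
    Matrix (Quad (Fin N)) (Quad (Fin N)) ℝ :=
  Matrix.of fun i j => cov[fun x => x i, fun x => x j; μ]

/-- The matrix of (uncentred) second moments of a random displacement. -/
noncomputable def momentMatrix (μ : Measure (Phase (Fin N))) :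
    Matrix (Quad (Fin N)) (Quad (Fin N)) ℝ :=
  Matrix.of fun i j => ∫ x, x i * x j ∂μ

/-- The geometric-mean error `(det V)^(1/2N)` of an output noise matrix of `N` modes. -/
noncomputable def gmError (V : Matrix (Quad (Fin N)) (Quad (Fin N)) ℝ) : ℝ :=
  V.det ^ (1 / (2 * (N : ℝ)))

end Code

end GKP

/-! The decoded noise `S⁻¹ξ` is a centred Gaussian, so its law depends only on `σ²P` with `P =
S⁻¹S⁻ᵀ`. This `P` is positive definite and symplectic, hence looks like the covariance matrix of a
pure Gaussian state shared by data and ancilla. Such states are modewise entangled: local symplectic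
maps bring `P` to the form `T_G⁻¹T_G⁻ᵀ` (`exists_local_reduction`), and equal covariances give equal
laws (`map_mulVec_gaussian_eq`).

For the normal form, Williamson's theorem diagonalizes the data block `A` with eigenvalues `ν i`.
Purity forces `ν i ≥ 1`. If `ν i = 1` the mode is uncorrelated with the ancilla; if `ν i > 1` the
correlation block carries its Williamson pair to one of the ancilla block `B` with the same
eigenvalue (`IsPure.partner`). These partners extend to a full Williamson basis of `B`, whose
further eigenvalues are `1` (`IsPure.exists_normal_form`). The gains solve `2G - 1 = ν`.

The ancillary map is absorbed by the lattice, since syndromes are symplectic products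
(`Lattice.syndrome_image`). The data map acts linearly on the residual displacement and has
determinant one, so the geometric-mean error is unchanged. -/

namespace GKP

/-! ### Linear images of white Gaussian noise -/

section Gaussian

variable {ι κ : Type*} [Fintype ι] [Fintype κ]

/-- Pairing `t` with `A x` is pairing `Aᵀ t` with `x`, and the characteristic function of a product
measure factorizes. Unlike densities, this also covers `v = 0` and singular `A`. -/
lemma charFun_map_mulVec_gaussian (v : ℝ≥0) (A : Matrix κ ι ℝ) (t : EuclideanSpace ℝ κ) :
    charFun ((Measure.pi fun _ : ι => gaussianReal 0 v).map
      (fun x => WithLp.toLp 2 (A *ᵥ x))) t =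
      Complex.exp (-(v * (t.ofLp ⬝ᵥ ((A * Aᵀ) *ᵥ t.ofLp)) / 2 : ℝ)) := by
  have hm : Measurable fun x : ι → ℝ => WithLp.toLp 2 (A *ᵥ x) := by
    apply Continuous.measurable
    fun_prop
  have h : charFun ((Measure.pi fun _ : ι => gaussianReal 0 v).map
        (fun x => WithLp.toLp 2 (A *ᵥ x))) t =
      charFun ((Measure.pi fun _ : ι => gaussianReal 0 v).map (WithLp.toLp 2))
        (WithLp.toLp 2 (Aᵀ *ᵥ t.ofLp)) := by
    rw [charFun_apply, charFun_apply, integral_map hm.aemeasurable (by fun_prop),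
      integral_map (by fun_prop) (by fun_prop)]
    congr 1
    ext x
    congr 3
    simp only [EuclideanSpace.inner_eq_star_dotProduct, star_trivial]
    rw [Matrix.dotProduct_mulVec, ← Matrix.mulVec_transpose]
  rw [h, charFun_pi]
  simp_rw [charFun_gaussianReal, ← Complex.exp_sum]
  congr 1
  have : t.ofLp ⬝ᵥ ((A * Aᵀ) *ᵥ t.ofLp) = ∑ i, (Aᵀ *ᵥ t.ofLp) i ^ 2 := by
    rw [← Matrix.mulVec_mulVec, Matrix.dotProduct_mulVec, ← Matrix.mulVec_transpose]
    simp [dotProduct, sq]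
  rw [this]
  push_cast
  rw [Finset.mul_sum, Finset.sum_div, ← Finset.sum_neg_distrib]
  simp

/-- The law of a linear image of white Gaussian noise depends only on its covariance matrix. -/
lemma map_mulVec_gaussian_eq (v : ℝ≥0) {A B : Matrix κ ι ℝ} (h : A * Aᵀ = B * Bᵀ) :
    (Measure.pi fun _ : ι => gaussianReal 0 v).map (fun x => A *ᵥ x) =
      (Measure.pi fun _ : ι => gaussianReal 0 v).map (fun x => B *ᵥ x) := by
  -- Characteristic functions need an inner product, hence the detour through `EuclideanSpace`.
  have key : ∀ A : Matrix κ ι ℝ, (Measure.pi fun _ : ι => gaussianReal 0 v).map (fun x => A *ᵥ x) =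
      ((Measure.pi fun _ : ι => gaussianReal 0 v).map (fun x => WithLp.toLp 2 (A *ᵥ x))).map
        (WithLp.ofLp) := by
    intro A
    rw [Measure.map_map (by fun_prop)
      (Continuous.measurable (by fun_prop))]
    rfl
  rw [key A, key B]
  have : IsProbabilityMeasure ((Measure.pi fun _ : ι => gaussianReal 0 v).map
    (fun x => WithLp.toLp 2 (A *ᵥ x))) :=
    Measure.isProbabilityMeasure_map (Continuous.measurable (by fun_prop)).aemeasurable
  have : IsProbabilityMeasure ((Measure.pi fun _ : ι => gaussianReal 0 v).map
    (fun x => WithLp.toLp 2 (B *ᵥ x))) :=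
    Measure.isProbabilityMeasure_map (Continuous.measurable (by fun_prop)).aemeasurable
  congr 1
  apply Measure.ext_of_charFun
  ext t
  rw [charFun_map_mulVec_gaussian, charFun_map_mulVec_gaussian, h]

end Gaussian

/-! ### Second moments under linear maps -/

section Moments

variable {N : ℕ} (μ : Measure (Phase (Fin N))) (Λ : Matrix (Quad (Fin N)) (Quad (Fin N)) ℝ)

lemma measurable_mulVec {m n : Type*} [Fintype m] [Fintype n] (A : Matrix m n ℝ) :
    Measurable fun x : n → ℝ => A *ᵥ x :=
  Continuous.measurable (by fun_prop)

variable {μ}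

lemma FiniteVariance.map_mulVec (h : FiniteVariance μ) :
    FiniteVariance (μ.map fun x => Λ *ᵥ x) := by
  intro i
  rw [memLp_map_measure_iff (Measurable.aestronglyMeasurable (by fun_prop))
    (measurable_mulVec Λ).aemeasurable]
  have : MemLp (fun x : Phase (Fin N) => ∑ j, Λ i j * x j) 2 μ :=
    memLp_finsetSum _ fun j _ => (h j).const_mul (Λ i j)
  exact this

lemma momentMatrix_map_mulVec (h : FiniteVariance μ) :
    momentMatrix (μ.map fun x => Λ *ᵥ x) = Λ * momentMatrix μ * Λᵀ := by
  ext i j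
  rw [momentMatrix, Matrix.of_apply, integral_map (measurable_mulVec Λ).aemeasurable
    (Measurable.aestronglyMeasurable (by fun_prop))]
  have hint : ∀ k l, Integrable (fun x : Phase (Fin N) => Λ i k * x k * (Λ j l * x l)) μ :=
    fun k l => MemLp.integrable_mul ((h k).const_mul (Λ i k)) ((h l).const_mul (Λ j l))
  simp only [Matrix.mulVec, dotProduct, Finset.sum_mul_sum]
  rw [integral_finsetSum _ fun k _ => integrable_finsetSum _ fun l _ => hint k l]
  simp only [Matrix.mul_apply, Matrix.transpose_apply, momentMatrix, Matrix.of_apply,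
    Finset.sum_mul]
  simp_rw [integral_finsetSum _ fun l _ => hint _ l]
  rw [Finset.sum_comm]
  refine Finset.sum_congr rfl fun l _ => Finset.sum_congr rfl fun k _ => ?_
  rw [← integral_const_mul, ← integral_mul_const]
  congr 1
  ext x
  ring

lemma covMatrix_map_mulVec [IsFiniteMeasure μ] (h : FiniteVariance μ) :
    covMatrix (μ.map fun x => Λ *ᵥ x) = Λ * covMatrix μ * Λᵀ := by
  ext i j
  rw [covMatrix, Matrix.of_apply, covariance_map_fun
    (Measurable.aestronglyMeasurable (by fun_prop)) (Measurable.aestronglyMeasurable (by fun_prop))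
    (measurable_mulVec Λ).aemeasurable]
  simp only [Matrix.mulVec, dotProduct]
  rw [covariance_fun_sum_fun_sum (fun k => (h k).const_mul (Λ i k))
    (fun l => (h l).const_mul (Λ j l))]
  simp only [covariance_const_mul_left, covariance_const_mul_right, Matrix.mul_apply,
    Matrix.transpose_apply, covMatrix, Matrix.of_apply, Finset.sum_mul]
  rw [Finset.sum_comm]
  refine Finset.sum_congr rfl fun l _ => Finset.sum_congr rfl fun k _ => ?_
  ring

/-- Symplectic matrices have determinant one, so the two determinants agree before the root is
taken, whatever their sign and also for `N = 0`. -/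
lemma gmError_symplectic_conj (V : Matrix (Quad (Fin N)) (Quad (Fin N)) ℝ) (hΛ : Λ ∈ Sp (Fin N)) :
    gmError (Λ * V * Λᵀ) = gmError V := by
  simp [gmError, SymplecticGroup.det_eq_one hΛ]

end Moments

/-! ### Spectral theorem for an arbitrary inner product -/

section Eigenvector

/-- A symmetric operator for a positive definite symmetric bilinear form on a nonzero
finite-dimensional real vector space has an eigenvector. -/
lemma exists_eigenvector_of_symmetric {V : Type*} [AddCommGroup V] [Module ℝ V]
    [FiniteDimensional ℝ V] [Nontrivial V] (B : V →ₗ[ℝ] V →ₗ[ℝ] ℝ)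
    (hB : ∀ x y, B x y = B y x) (hpos : ∀ x, x ≠ 0 → 0 < B x x) (T : V →ₗ[ℝ] V)
    (hT : ∀ x y, B (T x) y = B x (T y)) : ∃ (r : ℝ) (x : V), x ≠ 0 ∧ T x = r • x := by
  let core : InnerProductSpace.Core ℝ V :=
    { inner := fun x y => B x y
      conj_inner_symm := fun x y => by simp [hB x y]
      re_inner_nonneg := fun x => by
        by_cases h : x = 0
        · simp [h]
        · simpa using (hpos x h).le
      add_left := fun x y z => by simp
      smul_left := fun x y r => by simp
      definite := fun x h => by
        by_contra hx
        exact (hpos x hx).ne' h }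
  let _ : NormedAddCommGroup V := core.toNormedAddCommGroup
  let _ : InnerProductSpace ℝ V := InnerProductSpace.ofCore core.toCore
  have hsymm : T.IsSymmetric := fun x y => hT x y
  obtain ⟨x, hx⟩ := hsymm.hasEigenvalue_iSup_of_finiteDimensional.exists_hasEigenvector
  exact ⟨_, x, hx.2, hx.apply_eq_smul⟩

end Eigenvector

/-! ### Algebra of the symplectic form -/

section Omega

variable {α : Type} [DecidableEq α]

lemma Omega_eq_neg_J : Omega α = -Matrix.J α ℝ := by
  simp [Omega, Matrix.J, Matrix.fromBlocks_neg]

lemma Omega_transpose : (Omega α)ᵀ = -Omega α := by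
  simp [Omega_eq_neg_J]

variable [Fintype α]

lemma Omega_mul_Omega : Omega α * Omega α = -1 := by
  simp [Omega_eq_neg_J, Matrix.J_squared]

lemma Omega_mulVec_Omega_mulVec (x : Phase α) : Omega α *ᵥ (Omega α *ᵥ x) = -x := by
  simp [Omega_mul_Omega, Matrix.neg_mulVec]

lemma Omega_mulVec_dotProduct (x y : Phase α) :
    (Omega α *ᵥ x) ⬝ᵥ y = -(x ⬝ᵥ (Omega α *ᵥ y)) := by
  rw [Matrix.dotProduct_mulVec, ← Matrix.mulVec_transpose, Omega_transpose, Matrix.neg_mulVec,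
    neg_dotProduct, neg_neg]

lemma dotProduct_Omega_swap (x y : Phase α) :
    x ⬝ᵥ (Omega α *ᵥ y) = -(y ⬝ᵥ (Omega α *ᵥ x)) := by
  rw [← Omega_mulVec_dotProduct, dotProduct_comm]

lemma dotProduct_Omega_self (x : Phase α) : x ⬝ᵥ (Omega α *ᵥ x) = 0 := by
  have := dotProduct_Omega_swap x x
  linarith

lemma mem_Sp_iff (A : Matrix (Quad α) (Quad α) ℝ) : A ∈ Sp α ↔ A * Omega α * Aᵀ = Omega α := by
  rw [SymplecticGroup.mem_iff, Omega_eq_neg_J]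
  simp

lemma mem_Sp_iff' (A : Matrix (Quad α) (Quad α) ℝ) : A ∈ Sp α ↔ Aᵀ * Omega α * A = Omega α := by
  rw [SymplecticGroup.mem_iff', Omega_eq_neg_J]
  simp

end Omega

/-! ### Williamson's theorem -/

section Williamson

variable {α : Type} [DecidableEq α] [Fintype α]

/-- The vectors `e i`, `f i` for `i ∈ s` are a symplectic family on which the quadratic form `A`
is in Williamson normal form with symplectic eigenvalues `ν i`. -/
structure IsWilliamson {κ : Type} [DecidableEq κ] (A : Matrix (Quad α) (Quad α) ℝ) (s : Finset κ)
    (e f : κ → Phase α) (ν : κ → ℝ) : Prop where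
  pos : ∀ i ∈ s, 0 < ν i
  ee : ∀ i ∈ s, ∀ j ∈ s, e i ⬝ᵥ (Omega α *ᵥ e j) = 0
  ff : ∀ i ∈ s, ∀ j ∈ s, f i ⬝ᵥ (Omega α *ᵥ f j) = 0
  ef : ∀ i ∈ s, ∀ j ∈ s, e i ⬝ᵥ (Omega α *ᵥ f j) = if i = j then 1 else 0
  left : ∀ i ∈ s, A *ᵥ e i = ν i • (Omega α *ᵥ f i)
  right : ∀ i ∈ s, A *ᵥ f i = -(ν i • (Omega α *ᵥ e i))

variable {A : Matrix (Quad α) (Quad α) ℝ}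

/-- The operator `X = A⁻¹Ω` is skew for the inner product given by `A`, so `X²` is symmetric and
negative definite. An eigenvector `x` of `X²` in `W` and its image `X x` yield the pair after
rescaling. -/
lemma exists_williamson_pair_mem (hA : A.PosDef) (W : Submodule ℝ (Phase α)) (hW : W ≠ ⊥)
    (hinv : ∀ x ∈ W, A⁻¹ *ᵥ (Omega α *ᵥ x) ∈ W) :
    ∃ (e f : Phase α) (ν : ℝ), e ∈ W ∧ f ∈ W ∧ 0 < ν ∧ e ⬝ᵥ (Omega α *ᵥ f) = 1 ∧
      A *ᵥ e = ν • (Omega α *ᵥ f) ∧ A *ᵥ f = -(ν • (Omega α *ᵥ e)) := by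
  have hdet : IsUnit A.det := hA.det_pos.ne'.isUnit
  have hsymm : ∀ x y : Phase α, (A *ᵥ x) ⬝ᵥ y = x ⬝ᵥ (A *ᵥ y) := by
    intro x y
    rw [Matrix.dotProduct_mulVec, ← Matrix.mulVec_transpose]
    congr 2
    simpa using hA.isHermitian.eq.symm
  have hpos : ∀ x : Phase α, x ≠ 0 → 0 < x ⬝ᵥ (A *ᵥ x) := fun x hx => by
    simpa using hA.dotProduct_mulVec_pos hx
  have hAinv : ∀ x : Phase α, A *ᵥ (A⁻¹ *ᵥ x) = x := fun x => by
    rw [Matrix.mulVec_mulVec, Matrix.mul_nonsing_inv _ hdet, Matrix.one_mulVec]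
  set X : Phase α →ₗ[ℝ] Phase α := (A⁻¹ * Omega α).mulVecLin with hX
  have hXapp : ∀ x, X x = A⁻¹ *ᵥ (Omega α *ᵥ x) := fun x => by simp [hX]
  have hAX : ∀ x, A *ᵥ X x = Omega α *ᵥ x := fun x => by rw [hXapp, hAinv]
  have hXW : ∀ x ∈ W, X x ∈ W := fun x hx => by rw [hXapp]; exact hinv x hx
  have hskew : ∀ x y, (X x) ⬝ᵥ (A *ᵥ y) = -(x ⬝ᵥ (A *ᵥ X y)) := fun x y => by
    rw [← hsymm, hAX, hAX, Omega_mulVec_dotProduct]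
  have : Nontrivial W := Submodule.nontrivial_iff_ne_bot.2 hW
  obtain ⟨r, ⟨x, hxW⟩, hx0, hx⟩ := exists_eigenvector_of_symmetric
    (((Matrix.toLinearMap₂' ℝ A).domRestrict₁₂ W W))
    (fun x y => by
      simp only [LinearMap.domRestrict₁₂_apply, Matrix.toLinearMap₂'_apply']
      rw [← hsymm, dotProduct_comm])
    (fun x hx => by
      simp only [LinearMap.domRestrict₁₂_apply, Matrix.toLinearMap₂'_apply']
      exact hpos _ (by simpa using hx))
    ((X.restrict hXW) ∘ₗ (X.restrict hXW))
    (fun x y => by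
      simp only [LinearMap.domRestrict₁₂_apply, Matrix.toLinearMap₂'_apply',
        LinearMap.comp_apply, LinearMap.coe_restrict_apply]
      rw [hskew, hskew, neg_neg])
  have hx' : X (X x) = r • x := by simpa using congrArg Subtype.val hx
  have hx0' : x ≠ 0 := fun h => hx0 (by ext1; exact h)
  have hXx : X x ≠ 0 := fun h => hx0' <| by
    have h2 := hAX x
    rw [h, Matrix.mulVec_zero] at h2
    have := Omega_mulVec_Omega_mulVec x
    rw [← h2, Matrix.mulVec_zero] at this
    simpa using this.symm
  have hr : r < 0 := by
    have h1 := hpos _ hXx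
    rw [hskew, hx', Matrix.mulVec_smul, dotProduct_smul, smul_eq_mul] at h1
    have h2 := hpos _ hx0'
    nlinarith
  -- `A f = -νΩe` means `f = -νXe`; then `A e = νΩf` becomes `ν²r = -1`.
  set ν := √(-r⁻¹) with hν
  have hνpos : 0 < ν := Real.sqrt_pos.2 (by simpa using hr)
  have hν2 : ν * ν * r = -1 := by
    rw [hν, Real.mul_self_sqrt (by simpa using hr.le)]
    field_simp [hr.ne]
  set q := x ⬝ᵥ (A *ᵥ x) with hq
  have hqpos : 0 < q := hpos _ hx0'
  -- Normalizes the symplectic product: `e ⬝ Ωf = (e ⬝ Ae) / ν = a²q / ν = 1`.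
  set a := √(ν / q)
  have ha : a * a * q = ν := by
    rw [Real.mul_self_sqrt (by positivity)]
    field_simp
  have hΩf : ν • (Omega α *ᵥ (-(ν • X (a • x)))) = A *ᵥ (a • x) := by
    rw [← hAX, map_neg, map_smul, map_smul, map_smul, hx', Matrix.mulVec_neg, smul_smul, smul_smul,
      Matrix.mulVec_smul, Matrix.mulVec_smul, smul_neg, smul_smul, ← neg_smul]
    congr 1
    linear_combination (-a) * hν2
  refine ⟨a • x, -(ν • X (a • x)), ν, W.smul_mem _ hxW,
    W.neg_mem (W.smul_mem _ (hXW _ (W.smul_mem _ hxW))), hνpos, ?_, hΩf.symm, ?_⟩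
  · have : ν * ((a • x) ⬝ᵥ (Omega α *ᵥ (-(ν • X (a • x))))) = ν * 1 := by
      rw [← smul_eq_mul, ← dotProduct_smul, hΩf, Matrix.mulVec_smul, dotProduct_smul,
        smul_dotProduct, smul_eq_mul, smul_eq_mul, ← hq]
      linarith
    exact mul_left_cancel₀ hνpos.ne' this
  · rw [Matrix.mulVec_neg, Matrix.mulVec_smul, hAX]

/-- These are `2|s|` linear conditions on a space of larger dimension `2|α|`. -/
lemma exists_ne_zero_symplectic_orthogonal {κ : Type} [DecidableEq κ] (s : Finset κ)
    (hs : s.card < Fintype.card α) (e f : κ → Phase α) :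
    ∃ x : Phase α, x ≠ 0 ∧ ∀ i ∈ s, x ⬝ᵥ (Omega α *ᵥ e i) = 0 ∧ x ⬝ᵥ (Omega α *ᵥ f i) = 0 := by
  let R : Matrix (s ⊕ s) (Quad α) ℝ :=
    Matrix.of (Sum.elim (fun i => Omega α *ᵥ e i) (fun i => Omega α *ᵥ f i))
  have hlt : Module.finrank ℝ (s ⊕ s → ℝ) < Module.finrank ℝ (Phase α) := by
    simp only [Module.finrank_fintype_fun_eq_card, Fintype.card_sum, Fintype.card_coe]
    omega
  obtain ⟨x, hx, hx0⟩ := (Submodule.ne_bot_iff _).1 (LinearMap.ker_ne_bot_of_finrank_lt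
    (f := R.mulVecLin) hlt)
  refine ⟨x, hx0, fun i hi => ⟨?_, ?_⟩⟩
  · rw [dotProduct_comm]
    exact congrFun hx (Sum.inl ⟨i, hi⟩)
  · rw [dotProduct_comm]
    exact congrFun hx (Sum.inr ⟨i, hi⟩)

/-- The symplectic complement of the family is nonzero and invariant under `A⁻¹Ω`, so a new pair can
be found inside it. -/
lemma IsWilliamson.exists_insert {κ : Type} [DecidableEq κ] (hA : A.PosDef) {s : Finset κ}
    {e f : κ → Phase α} {ν : κ → ℝ} (h : IsWilliamson A s e f ν) (hs : s.card < Fintype.card α)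
    {j : κ} (hj : j ∉ s) : ∃ (x y : Phase α) (μ : ℝ),
      IsWilliamson A (insert j s) (Function.update e j x) (Function.update f j y)
        (Function.update ν j μ) := by
  have hdet : IsUnit A.det := hA.det_pos.ne'.isUnit
  have hsymm : ∀ x y : Phase α, (A *ᵥ x) ⬝ᵥ y = x ⬝ᵥ (A *ᵥ y) := by
    intro x y
    rw [Matrix.dotProduct_mulVec, ← Matrix.mulVec_transpose]
    congr 2
    simpa using hA.isHermitian.eq.symm
  have hAinv : ∀ x : Phase α, A *ᵥ (A⁻¹ *ᵥ x) = x := fun x => by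
    rw [Matrix.mulVec_mulVec, Matrix.mul_nonsing_inv _ hdet, Matrix.one_mulVec]
  let W : Submodule ℝ (Phase α) :=
    { carrier := {x | ∀ i ∈ s, x ⬝ᵥ (Omega α *ᵥ e i) = 0 ∧ x ⬝ᵥ (Omega α *ᵥ f i) = 0}
      add_mem' := fun {x y} hx hy i hi => by
        simp [add_dotProduct, hx i hi, hy i hi]
      zero_mem' := fun i hi => by simp
      smul_mem' := fun c x hx i hi => by simp [smul_dotProduct, hx i hi] }
  have hW : W ≠ ⊥ := by
    obtain ⟨x, hx0, hx⟩ := exists_ne_zero_symplectic_orthogonal s hs e f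
    exact (Submodule.ne_bot_iff _).2 ⟨x, hx, hx0⟩
  -- Up to the nonzero factor `±ν i`, `Ω e i` is `A (f i)` and `Ω f i` is `A (e i)`; moving `A`
  -- across the product cancels `A⁻¹` and leaves a symplectic product of `x` with the family.
  have hinv : ∀ x ∈ W, A⁻¹ *ᵥ (Omega α *ᵥ x) ∈ W := by
    intro x hx i hi
    have hν := (h.pos i hi).ne'
    constructor
    · have : ν i * ((A⁻¹ *ᵥ (Omega α *ᵥ x)) ⬝ᵥ (Omega α *ᵥ e i)) = 0 := by
        rw [← smul_eq_mul, ← dotProduct_smul, ← neg_neg (ν i • _), ← h.right i hi,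
          dotProduct_neg, ← hsymm, hAinv, Omega_mulVec_dotProduct, (hx i hi).2, neg_zero, neg_zero]
      exact (mul_eq_zero.1 this).resolve_left hν
    · have : ν i * ((A⁻¹ *ᵥ (Omega α *ᵥ x)) ⬝ᵥ (Omega α *ᵥ f i)) = 0 := by
        rw [← smul_eq_mul, ← dotProduct_smul, ← h.left i hi,
          ← hsymm, hAinv, Omega_mulVec_dotProduct, (hx i hi).1, neg_zero]
      exact (mul_eq_zero.1 this).resolve_left hν
  obtain ⟨x, y, μ, hx, hy, hμ, hxy, hl, hr⟩ := exists_williamson_pair_mem hA W hW hinv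
  refine ⟨x, y, μ, ?_⟩
  have hne : ∀ i ∈ s, i ≠ j := fun i hi hij => hj (hij ▸ hi)
  constructor
  · intro i hi
    rcases Finset.mem_insert.1 hi with rfl | hi
    · simpa using hμ
    · simpa [hne i hi] using h.pos i hi
  · intro i hi k hk
    rcases Finset.mem_insert.1 hi with rfl | hi' <;> rcases Finset.mem_insert.1 hk with rfl | hk'
    · simpa using dotProduct_Omega_self x
    · simpa [hne k hk'] using (hx k hk').1
    · rw [dotProduct_Omega_swap]
      simpa [hne i hi'] using (hx i hi').1
    · simpa [hne i hi', hne k hk'] using h.ee i hi' k hk'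
  · intro i hi k hk
    rcases Finset.mem_insert.1 hi with rfl | hi' <;> rcases Finset.mem_insert.1 hk with rfl | hk'
    · simpa using dotProduct_Omega_self y
    · simpa [hne k hk'] using (hy k hk').2
    · rw [dotProduct_Omega_swap]
      simpa [hne i hi'] using (hy i hi').2
    · simpa [hne i hi', hne k hk'] using h.ff i hi' k hk'
  · intro i hi k hk
    rcases Finset.mem_insert.1 hi with rfl | hi' <;> rcases Finset.mem_insert.1 hk with rfl | hk'
    · simpa using hxy
    · simpa [hne k hk', (hne k hk').symm] using (hx k hk').2
    · rw [dotProduct_Omega_swap]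
      simpa [hne i hi'] using (hy i hi').1
    · simpa [hne i hi', hne k hk'] using h.ef i hi' k hk'
  · intro i hi
    rcases Finset.mem_insert.1 hi with rfl | hi
    · simpa using hl
    · simpa [hne i hi] using h.left i hi
  · intro i hi
    rcases Finset.mem_insert.1 hi with rfl | hi
    · simpa using hr
    · simpa [hne i hi] using h.right i hi

/-- Every partial Williamson family extends to a full one. -/
lemma IsWilliamson.exists_extension (hA : A.PosDef) {s : Finset α} {e f : α → Phase α} {ν : α → ℝ}
    (h : IsWilliamson A s e f ν) : ∃ (e' f' : α → Phase α) (ν' : α → ℝ),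
      IsWilliamson A Finset.univ e' f' ν' ∧ ∀ i ∈ s, e' i = e i ∧ f' i = f i ∧ ν' i = ν i := by
  -- Induction on the number of missing modes. The values outside `s` are arbitrary and get
  -- overwritten.
  suffices H : ∀ (n : ℕ) (s : Finset α) (e f : α → Phase α) (ν : α → ℝ),
      sᶜ.card = n → IsWilliamson A s e f ν → ∃ (e' f' : α → Phase α) (ν' : α → ℝ),
      IsWilliamson A Finset.univ e' f' ν' ∧ ∀ i ∈ s, e' i = e i ∧ f' i = f i ∧ ν' i = ν i from
    H _ s e f ν rfl h
  intro n
  induction n with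
  | zero =>
    intro s e f ν hs h
    have : s = Finset.univ := by simpa using hs
    subst this
    exact ⟨e, f, ν, h, by simp⟩
  | succ n ih =>
    intro s e f ν hs h
    obtain ⟨j, hj⟩ : sᶜ.Nonempty := Finset.card_pos.1 (by omega)
    have hj' : j ∉ s := Finset.mem_compl.1 hj
    have hcard : s.card < Fintype.card α := by
      rw [Finset.card_compl] at hs
      omega
    obtain ⟨x, y, μ, hext⟩ := h.exists_insert hA hcard hj'
    obtain ⟨e', f', ν', hW, hagree⟩ := ih _ _ _ _ (by
      rw [Finset.card_compl] at hs ⊢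
      rw [Finset.card_insert_of_notMem hj']
      omega) hext
    refine ⟨e', f', ν', hW, fun i hi => ?_⟩
    have hij : i ≠ j := fun hij => hj' (hij ▸ hi)
    simpa [hij] using hagree i (Finset.mem_insert_of_mem hi)

/-- **Williamson's theorem**. -/
lemma exists_isWilliamson (hA : A.PosDef) : ∃ (e f : α → Phase α) (ν : α → ℝ),
    IsWilliamson A Finset.univ e f ν := by
  have h : IsWilliamson A (∅ : Finset α) 0 0 0 := by constructor <;> simp
  obtain ⟨e, f, ν, h, -⟩ := h.exists_extension hA
  exact ⟨e, f, ν, h⟩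

/-- The matrix with rows `e i`, `f i`. -/
def rowMatrix {κ : Type} (e f : κ → Phase α) : Matrix (Quad κ) (Quad α) ℝ :=
  Matrix.of (Sum.elim e f)

omit [DecidableEq α] in
lemma rowMatrix_mul_mul_transpose {β κ κ' : Type} [Fintype β] (e f : κ → Phase α)
    (e' f' : κ' → Phase β) (C : Matrix (Quad α) (Quad β) ℝ) :
    rowMatrix e f * C * (rowMatrix e' f')ᵀ = Matrix.fromBlocks
      (Matrix.of fun i j => e i ⬝ᵥ (C *ᵥ e' j)) (Matrix.of fun i j => e i ⬝ᵥ (C *ᵥ f' j))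
      (Matrix.of fun i j => f i ⬝ᵥ (C *ᵥ e' j)) (Matrix.of fun i j => f i ⬝ᵥ (C *ᵥ f' j)) := by
  have : ∀ i j, (rowMatrix e f * C * (rowMatrix e' f')ᵀ) i j =
      rowMatrix e f i ⬝ᵥ (C *ᵥ rowMatrix e' f' j) := by
    intro i j
    rw [Matrix.mul_assoc, Matrix.mul_apply']
    rfl
  ext (i | i) (j | j) <;> rw [this] <;> rfl

/-- The index type `κ` may be smaller than `α`: equality of both gives a symplectic matrix, a
smaller `κ` serves the rank bound in `IsWilliamson.card_le`. -/
lemma rowMatrix_mul_Omega {κ : Type} [DecidableEq κ] {e f : κ → Phase α}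
    (hee : ∀ i j, e i ⬝ᵥ (Omega α *ᵥ e j) = 0) (hff : ∀ i j, f i ⬝ᵥ (Omega α *ᵥ f j) = 0)
    (hef : ∀ i j, e i ⬝ᵥ (Omega α *ᵥ f j) = if i = j then 1 else 0) :
    rowMatrix e f * Omega α * (rowMatrix e f)ᵀ = Omega κ := by
  rw [rowMatrix_mul_mul_transpose]
  refine (Matrix.fromBlocks_inj (A := _) (B := _)).2 ⟨?_, ?_, ?_, ?_⟩ <;> ext i j
  · exact hee i j
  · exact hef i j
  · rw [Matrix.of_apply, dotProduct_Omega_swap, hef j i, Matrix.neg_apply, Matrix.one_apply]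
    simp [eq_comm]
  · exact hff i j

lemma IsWilliamson.rowMatrix_mem {e f : α → Phase α} {ν : α → ℝ}
    (h : IsWilliamson A Finset.univ e f ν) : rowMatrix e f ∈ Sp α := by
  rw [mem_Sp_iff]
  exact rowMatrix_mul_Omega (fun i j => h.ee i (Finset.mem_univ _) j (Finset.mem_univ _))
    (fun i j => h.ff i (Finset.mem_univ _) j (Finset.mem_univ _))
    (fun i j => h.ef i (Finset.mem_univ _) j (Finset.mem_univ _))

/-- The Gram matrix of the family is the nondegenerate form on `s`, of rank `2|s|`, but factors
through a space of dimension `2|α|`. -/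
lemma IsWilliamson.card_le {κ : Type} [DecidableEq κ] {e f : κ → Phase α} {ν : κ → ℝ}
    {s : Finset κ} (h : IsWilliamson A s e f ν) : s.card ≤ Fintype.card α := by
  have hΩ : (Omega s).rank = Fintype.card (Quad s) := by
    apply Matrix.rank_of_isUnit
    rw [Omega_eq_neg_J]
    exact ((Matrix.isUnit_iff_isUnit_det _).2 (Matrix.isUnit_det_J s ℝ)).neg
  have h1 := Matrix.rank_mul_le_left (rowMatrix (fun i : s => e i) (fun i : s => f i))
    (Omega α * (rowMatrix (fun i : s => e i) (fun i : s => f i))ᵀ)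
  rw [← Matrix.mul_assoc, rowMatrix_mul_Omega (κ := s) (fun i j => h.ee i i.2 j j.2)
    (fun i j => h.ff i i.2 j j.2)
    (fun i j => by simp only [h.ef i i.2 j j.2, Subtype.coe_inj]), hΩ] at h1
  have h2 := h1.trans (Matrix.rank_le_card_width _)
  simp only [Fintype.card_sum, Fintype.card_coe] at h2
  omega

end Williamson

/-! ### Modewise entanglement of pure states -/

section NormalForm

variable {α β : Type} [DecidableEq α] [Fintype α] [DecidableEq β] [Fintype β]

/-- The covariance matrix of a pure Gaussian state of two groups of modes: `A` and `B` are the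
local covariance matrices and `C` is the matrix of the correlations. -/
structure IsPure (A : Matrix (Quad α) (Quad α) ℝ) (C : Matrix (Quad α) (Quad β) ℝ)
    (B : Matrix (Quad β) (Quad β) ℝ) : Prop where
  posDef_left : A.PosDef
  posDef_right : B.PosDef
  left : A * Omega α * A + C * Omega β * Cᵀ = Omega α
  mixed : Cᵀ * Omega α * A + B * Omega β * Cᵀ = 0
  right : Cᵀ * Omega α * C + B * Omega β * B = Omega β

variable {A : Matrix (Quad α) (Quad α) ℝ} {C : Matrix (Quad α) (Quad β) ℝ}
  {B : Matrix (Quad β) (Quad β) ℝ}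

namespace IsPure

variable (h : IsPure A C B)

include h

/-- Up to sign, `Cᵀ` intertwines `ΩA` with `BΩ`; this is how eigenvectors pass from one side to the
other. -/
lemma mixed_mulVec (x : Phase α) :
    B *ᵥ (Omega β *ᵥ (Cᵀ *ᵥ x)) = -(Cᵀ *ᵥ (Omega α *ᵥ (A *ᵥ x))) := by
  have := congrArg (· *ᵥ x) h.mixed
  simp only [Matrix.add_mulVec, Matrix.zero_mulVec, ← Matrix.mulVec_mulVec] at this
  exact eq_neg_of_add_eq_zero_right this

/-- From `CΩCᵀ = Ω - AΩA`. On a Williamson plane of `A` the right side is `1 - ν²` times the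
symplectic form. -/
lemma dotProduct_transpose_mulVec (x y : Phase α) :
    (Cᵀ *ᵥ x) ⬝ᵥ (Omega β *ᵥ (Cᵀ *ᵥ y)) =
      x ⬝ᵥ (Omega α *ᵥ y) - (A *ᵥ x) ⬝ᵥ (Omega α *ᵥ (A *ᵥ y)) := by
  have h1 := congrArg (fun P => x ⬝ᵥ (P *ᵥ y)) h.left
  simp only [Matrix.add_mulVec, dotProduct_add, ← Matrix.mulVec_mulVec] at h1
  have hA : ∀ z : Phase α, x ⬝ᵥ (A *ᵥ z) = (A *ᵥ x) ⬝ᵥ z := by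
    intro z
    rw [Matrix.dotProduct_mulVec, ← Matrix.mulVec_transpose]
    congr 2
    simpa using h.posDef_left.isHermitian.eq
  rw [hA, Matrix.dotProduct_mulVec x C, ← Matrix.mulVec_transpose C] at h1
  linarith

variable {κ : Type} [DecidableEq κ] {s : Finset κ} {e f : κ → Phase α} {ν : κ → ℝ}
  (hw : IsWilliamson A s e f ν)

include hw

lemma mulVec_left {i : κ} (hi : i ∈ s) :
    B *ᵥ (Omega β *ᵥ (Cᵀ *ᵥ e i)) = ν i • (Cᵀ *ᵥ f i) := by
  rw [h.mixed_mulVec, hw.left i hi, Matrix.mulVec_smul, Omega_mulVec_Omega_mulVec,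
    Matrix.mulVec_smul, Matrix.mulVec_neg, smul_neg, neg_neg]

lemma mulVec_right {i : κ} (hi : i ∈ s) :
    B *ᵥ (Omega β *ᵥ (Cᵀ *ᵥ f i)) = -(ν i • (Cᵀ *ᵥ e i)) := by
  rw [h.mixed_mulVec, hw.right i hi, Matrix.mulVec_neg, Matrix.mulVec_smul,
    Omega_mulVec_Omega_mulVec, Matrix.mulVec_neg, Matrix.mulVec_smul, Matrix.mulVec_neg, smul_neg,
    neg_neg]

lemma dot_left_left {i j : κ} (hi : i ∈ s) (hj : j ∈ s) :
    (Cᵀ *ᵥ e i) ⬝ᵥ (Omega β *ᵥ (Cᵀ *ᵥ e j)) = 0 := by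
  rw [h.dotProduct_transpose_mulVec, hw.left i hi, hw.left j hj, Matrix.mulVec_smul,
    Omega_mulVec_Omega_mulVec, smul_dotProduct, dotProduct_smul, dotProduct_neg,
    Omega_mulVec_dotProduct, dotProduct_Omega_swap, hw.ee j hj i hi, hw.ff i hi j hj]
  simp

lemma dot_right_right {i j : κ} (hi : i ∈ s) (hj : j ∈ s) :
    (Cᵀ *ᵥ f i) ⬝ᵥ (Omega β *ᵥ (Cᵀ *ᵥ f j)) = 0 := by
  rw [h.dotProduct_transpose_mulVec, hw.right i hi, hw.right j hj, Matrix.mulVec_neg,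
    Matrix.mulVec_smul, Omega_mulVec_Omega_mulVec, neg_dotProduct, dotProduct_neg,
    smul_dotProduct, dotProduct_smul, dotProduct_neg,
    Omega_mulVec_dotProduct, dotProduct_Omega_swap, hw.ff j hj i hi, hw.ee i hi j hj]
  simp

lemma dot_left_right {i j : κ} (hi : i ∈ s) (hj : j ∈ s) :
    (Cᵀ *ᵥ e i) ⬝ᵥ (Omega β *ᵥ (Cᵀ *ᵥ f j)) = if i = j then 1 - ν i ^ 2 else 0 := by
  rw [h.dotProduct_transpose_mulVec, hw.left i hi, hw.right j hj, Matrix.mulVec_neg,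
    Matrix.mulVec_smul, Omega_mulVec_Omega_mulVec, dotProduct_neg,
    smul_dotProduct, dotProduct_smul, dotProduct_neg,
    Omega_mulVec_dotProduct, dotProduct_Omega_swap (f i), hw.ef i hi j hj, hw.ef j hj i hi]
  by_cases hij : i = j
  · subst hij
    simp
    ring
  · simp [hij, Ne.symm hij]

lemma quadratic_left {i : κ} (hi : i ∈ s) :
    (Omega β *ᵥ (Cᵀ *ᵥ e i)) ⬝ᵥ (B *ᵥ (Omega β *ᵥ (Cᵀ *ᵥ e i))) = ν i * (ν i ^ 2 - 1) := by
  rw [h.mulVec_left hw hi, dotProduct_smul, Omega_mulVec_dotProduct, h.dot_left_right hw hi hi,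
    if_pos rfl, smul_eq_mul]
  ring

lemma quadratic_right {i : κ} (hi : i ∈ s) :
    (Omega β *ᵥ (Cᵀ *ᵥ f i)) ⬝ᵥ (B *ᵥ (Omega β *ᵥ (Cᵀ *ᵥ f i))) = ν i * (ν i ^ 2 - 1) := by
  rw [h.mulVec_right hw hi, dotProduct_neg, dotProduct_smul, dotProduct_comm,
    h.dot_left_right hw hi hi, if_pos rfl, smul_eq_mul]
  ring

/-- The uncertainty principle: `ν(ν² - 1)` is a value of the positive definite form `B`. -/
lemma one_le {i : κ} (hi : i ∈ s) : 1 ≤ ν i := by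
  have h1 : 0 ≤ ν i * (ν i ^ 2 - 1) := by
    rw [← h.quadratic_left hw hi]
    simpa using h.posDef_right.posSemidef.dotProduct_mulVec_nonneg (Omega β *ᵥ (Cᵀ *ᵥ e i))
  have h2 := nonneg_of_mul_nonneg_right h1 (hw.pos i hi)
  nlinarith [hw.pos i hi]

omit hw in
lemma eq_zero_of_quadratic {x : Phase β}
    (hx : (Omega β *ᵥ x) ⬝ᵥ (B *ᵥ (Omega β *ᵥ x)) = 0) : x = 0 := by
  have : Omega β *ᵥ x = 0 := by
    by_contra hne
    have hpos := h.posDef_right.dotProduct_mulVec_pos hne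
    rw [star_trivial, hx] at hpos
    exact lt_irrefl _ hpos
  have h2 := Omega_mulVec_Omega_mulVec x
  rw [this, Matrix.mulVec_zero] at h2
  exact neg_eq_zero.1 h2.symm

/-- At `ν = 1` that value of `B` is zero, so the mode has no correlations with the other side. -/
lemma left_eq_zero {i : κ} (hi : i ∈ s) (h1 : ν i = 1) : Cᵀ *ᵥ e i = 0 :=
  h.eq_zero_of_quadratic (by rw [h.quadratic_left hw hi, h1]; norm_num)

lemma right_eq_zero {i : κ} (hi : i ∈ s) (h1 : ν i = 1) : Cᵀ *ᵥ f i = 0 :=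
  h.eq_zero_of_quadratic (by rw [h.quadratic_right hw hi, h1]; norm_num)

/-- The partner modes of the entangled modes of a Williamson family. -/
lemma partner {κ' : Type} [DecidableEq κ'] {t : Finset κ'} {r : κ' → κ}
    (hr : ∀ j ∈ t, r j ∈ s) (hinj : Set.InjOn r t) (hν : ∀ j ∈ t, 1 < ν (r j)) :
    IsWilliamson B t (fun j => (√(ν (r j) ^ 2 - 1))⁻¹ • (Omega β *ᵥ (Cᵀ *ᵥ f (r j))))
      (fun j => (√(ν (r j) ^ 2 - 1))⁻¹ • (Omega β *ᵥ (Cᵀ *ᵥ e (r j)))) (fun j => ν (r j)) := by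
  -- The roles of `e` and `f` are exchanged because `Cᵀ` multiplies the symplectic product by `1 -
  -- ν² < 0`; the factor `(√(ν² - 1))⁻¹` restores the value one.
  constructor
  · intro i hi
    exact hw.pos _ (hr i hi)
  · intro i hi j hj
    simp only [Matrix.mulVec_smul, Omega_mulVec_Omega_mulVec, smul_dotProduct, dotProduct_smul,
      dotProduct_neg]
    rw [dotProduct_comm, h.dot_right_right hw (hr j hj) (hr i hi)]
    simp
  · intro i hi j hj
    simp only [Matrix.mulVec_smul, Omega_mulVec_Omega_mulVec, smul_dotProduct, dotProduct_smul,
      dotProduct_neg]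
    rw [dotProduct_comm, h.dot_left_left hw (hr j hj) (hr i hi)]
    simp
  · intro i hi j hj
    simp only [Matrix.mulVec_smul, Omega_mulVec_Omega_mulVec, smul_dotProduct, dotProduct_smul,
      dotProduct_neg]
    rw [dotProduct_comm, h.dot_left_right hw (hr j hj) (hr i hi)]
    by_cases hij : i = j
    · subst hij
      have hpos : 0 < ν (r i) ^ 2 - 1 := by nlinarith [hν i hi]
      have hs := Real.sq_sqrt hpos.le
      have hs' := (Real.sqrt_pos.2 hpos).ne'
      simp only [if_true, smul_eq_mul]
      field_simp
      linarith
    · rw [if_neg fun hh => hij (hinj hi hj hh.symm), if_neg hij]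
      simp
  · intro i hi
    simp only [Matrix.mulVec_smul, Omega_mulVec_Omega_mulVec]
    rw [h.mulVec_right hw (hr i hi), ← smul_neg, smul_comm]
  · intro i hi
    simp only [Matrix.mulVec_smul, Omega_mulVec_Omega_mulVec]
    rw [h.mulVec_left hw (hr i hi), smul_comm, smul_neg, smul_neg, neg_neg]

omit hw in
-- Where `C` vanishes, `BΩB` acts as `Ω`, so `μ² = 1`.
lemma eigenvalue_eq_one {t : Finset κ} {e' f' : κ → Phase β} {μ : κ → ℝ}
    (hw' : IsWilliamson B t e' f' μ) {j : κ} (hj : j ∈ t) (hC : C *ᵥ e' j = 0) : μ j = 1 := by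
  have h1 := congrArg (fun P => f' j ⬝ᵥ (P *ᵥ e' j)) h.right
  simp only [Matrix.add_mulVec, ← Matrix.mulVec_mulVec, hC, Matrix.mulVec_zero, zero_add] at h1
  rw [hw'.left j hj, Matrix.mulVec_smul, Omega_mulVec_Omega_mulVec, Matrix.mulVec_smul,
    Matrix.mulVec_neg, hw'.right j hj, neg_neg, dotProduct_smul, dotProduct_smul,
    dotProduct_Omega_swap, hw'.ef j hj j hj] at h1
  simp only [if_true, smul_eq_mul] at h1
  nlinarith [hw'.pos j hj]

end IsPure

lemma IsWilliamson.eq_zero_of_dotProduct {e f : α → Phase α} {ν : α → ℝ}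
    (hw : IsWilliamson A Finset.univ e f ν) {x : Phase α} (he : ∀ i, e i ⬝ᵥ x = 0)
    (hf : ∀ i, f i ⬝ᵥ x = 0) : x = 0 := by
  have hdet := SymplecticGroup.symplectic_det hw.rowMatrix_mem
  have h0 : rowMatrix e f *ᵥ x = 0 := by
    ext (i | i)
    · exact he i
    · exact hf i
  exact Matrix.eq_zero_of_mulVec_eq_zero hdet.ne_zero h0

lemma IsWilliamson.comp_perm {e f : α → Phase α} {ν : α → ℝ}
    (hw : IsWilliamson A Finset.univ e f ν) (σ : Equiv.Perm α) :
    IsWilliamson A Finset.univ (e ∘ σ) (f ∘ σ) (ν ∘ σ) where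
  pos i _ := hw.pos _ (Finset.mem_univ _)
  ee i _ j _ := hw.ee _ (Finset.mem_univ _) _ (Finset.mem_univ _)
  ff i _ j _ := hw.ff _ (Finset.mem_univ _) _ (Finset.mem_univ _)
  ef i _ j _ := by simpa using hw.ef _ (Finset.mem_univ (σ i)) _ (Finset.mem_univ (σ j))
  left i _ := hw.left _ (Finset.mem_univ _)
  right i _ := hw.right _ (Finset.mem_univ _)

/-- Lets the entangled modes come first, as the squeezers couple modes of equal index. -/
lemma exists_perm_iff_lt {N : ℕ} (p : Fin N → Prop) :
    ∃ (k : ℕ) (σ : Equiv.Perm (Fin N)), k ≤ N ∧ ∀ i, p (σ i) ↔ (i : ℕ) < k := by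
  classical
  have hk : Fintype.card {i // p i} ≤ N := by
    simpa using Fintype.card_subtype_le p
  have hcard : Fintype.card {i : Fin N // (i : ℕ) < Fintype.card {i // p i}} =
      Fintype.card {i // p i} := by
    rw [Fintype.card_subtype, Fin.card_filter_val_lt, min_eq_right hk]
  let σ := (Fintype.equivOfCardEq hcard).extendSubtype
  refine ⟨Fintype.card {i // p i}, σ, hk, fun i => ⟨fun h => ?_, fun h => ?_⟩⟩
  · by_contra hi
    exact (Fintype.equivOfCardEq hcard).extendSubtype_not_mem i hi h
  · exact (Fintype.equivOfCardEq hcard).extendSubtype_mem i h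

/-- Modewise entanglement: the bipartite normal form of the covariance matrix of a pure state. -/
lemma IsPure.exists_normal_form {N M : ℕ} {A : Matrix (Quad (Fin N)) (Quad (Fin N)) ℝ}
    {C : Matrix (Quad (Fin N)) (Quad (Fin M)) ℝ} {B : Matrix (Quad (Fin M)) (Quad (Fin M)) ℝ}
    (h : IsPure A C B) : ∃ (e f : Fin N → Phase (Fin N)) (ν : Fin N → ℝ)
      (e' f' : Fin M → Phase (Fin M)) (μ : Fin M → ℝ),
      IsWilliamson A Finset.univ e f ν ∧ IsWilliamson B Finset.univ e' f' μ ∧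
      (∀ i, 1 ≤ ν i) ∧ (∀ i : Fin N, M ≤ i → ν i = 1) ∧ (∀ j : Fin M, N ≤ j → μ j = 1) ∧
      (∀ (i : Fin N) (j : Fin M), (i : ℕ) = j → μ j = ν i) ∧
      (∀ i j, e i ⬝ᵥ (C *ᵥ e' j) = if (i : ℕ) = j then -√(ν i ^ 2 - 1) else 0) ∧
      (∀ i j, f i ⬝ᵥ (C *ᵥ f' j) = if (i : ℕ) = j then √(ν i ^ 2 - 1) else 0) ∧
      (∀ i j, e i ⬝ᵥ (C *ᵥ f' j) = 0) ∧ (∀ i j, f i ⬝ᵥ (C *ᵥ e' j) = 0) := by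
  obtain ⟨e₀, f₀, ν₀, hw₀⟩ := exists_isWilliamson h.posDef_left
  obtain ⟨k, σ, hkN, hk⟩ := exists_perm_iff_lt fun i => 1 < ν₀ i
  have hw := hw₀.comp_perm σ
  generalize e₀ ∘ σ = e at hw
  generalize f₀ ∘ σ = f at hw
  have hνk : ∀ i, 1 < (ν₀ ∘ σ) i ↔ (i : ℕ) < k := hk
  generalize ν₀ ∘ σ = ν at hw hνk
  clear hk hw₀
  have hν1 : ∀ i, 1 ≤ ν i := fun i => h.one_le hw (Finset.mem_univ i)
  have hν1' : ∀ i : Fin N, k ≤ i → ν i = 1 := fun i hi =>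
    le_antisymm (not_lt.1 fun hh => absurd ((hνk i).1 hh) (not_lt.2 hi)) (hν1 i)
  -- The partners of the `k` entangled data modes form a symplectic family among `M` modes.
  have hkM : k ≤ M := by
    have hp := h.partner hw (κ' := Fin k) (t := Finset.univ) (r := Fin.castLE hkN)
      (fun _ _ => Finset.mem_univ _) (Fin.castLE_injective hkN).injOn
      (fun j _ => (hνk _).2 j.2)
    simpa using hp.card_le
  rcases Nat.eq_zero_or_pos N with hN0 | hN0
  · subst hN0
    obtain ⟨e', f', μ, hw'⟩ := exists_isWilliamson h.posDef_right
    refine ⟨e, f, ν, e', f', μ, hw, hw', hν1, fun i => i.elim0, fun j _ => ?_, fun i => i.elim0,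
      fun i => i.elim0, fun i => i.elim0, fun i => i.elim0, fun i => i.elim0⟩
    exact h.eigenvalue_eq_one hw' (Finset.mem_univ j) (Subsingleton.elim _ _)
  -- The remainder modulo `N` only makes the index map total; it is used for `j < k ≤ N`, where it
  -- is the identity. It needs `N > 0`, hence the separate case above.
  have hr : ∀ j : Fin M, (j : ℕ) < k → ((⟨(j : ℕ) % N, Nat.mod_lt _ hN0⟩ : Fin N) : ℕ) = j :=
    fun j hj => Nat.mod_eq_of_lt (hj.trans_le hkN)
  set r : Fin M → Fin N := fun j => ⟨(j : ℕ) % N, Nat.mod_lt _ hN0⟩ with hrdef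
  set t : Finset (Fin M) := {j | (j : ℕ) < k} with ht
  have hp := h.partner hw (t := t) (r := r) (fun _ _ => Finset.mem_univ _)
    (fun i hi j hj hij => by
      have hi' : (i : ℕ) < k := by simpa [ht] using hi
      have hj' : (j : ℕ) < k := by simpa [ht] using hj
      have := congrArg Fin.val hij
      rw [hr i hi', hr j hj'] at this
      exact Fin.ext this)
    (fun j hj => (hνk _).2 (by
      have hj' : (j : ℕ) < k := by simpa [ht] using hj
      rwa [hr j hj']))
  obtain ⟨e', f', μ, hw', hag⟩ := hp.exists_extension h.posDef_right
  have hag' : ∀ (i : Fin N) (j : Fin M), (i : ℕ) < k → (i : ℕ) = j →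
      Cᵀ *ᵥ f i = -(√(ν i ^ 2 - 1) • (Omega _ *ᵥ e' j)) ∧
      Cᵀ *ᵥ e i = -(√(ν i ^ 2 - 1) • (Omega _ *ᵥ f' j)) ∧ μ j = ν i := by
    intro i j hi hij
    have hj : (j : ℕ) < k := hij ▸ hi
    have hri : r j = i := Fin.ext ((hr j hj).trans hij.symm)
    obtain ⟨h1, h2, h3⟩ := hag j (by simpa [ht] using hj)
    rw [hri] at h1 h2 h3
    have hpos : 0 < ν i ^ 2 - 1 := by nlinarith [(hνk i).2 hi]
    have hs := (Real.sqrt_pos.2 hpos).ne'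
    refine ⟨?_, ?_, h3⟩
    · rw [h1, Matrix.mulVec_smul, smul_smul, mul_inv_cancel₀ hs, Omega_mulVec_Omega_mulVec]
      simp
    · rw [h2, Matrix.mulVec_smul, smul_smul, mul_inv_cancel₀ hs, Omega_mulVec_Omega_mulVec]
      simp
  have hC : ∀ (x : Phase (Fin N)) (y : Phase (Fin M)), x ⬝ᵥ (C *ᵥ y) = (Cᵀ *ᵥ x) ⬝ᵥ y :=
    fun x y => by rw [Matrix.dotProduct_mulVec, ← Matrix.mulVec_transpose]
  have hentries : ∀ (i : Fin N) (j : Fin M),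
      e i ⬝ᵥ (C *ᵥ e' j) = (if (i : ℕ) = j then -√(ν i ^ 2 - 1) else 0) ∧
      f i ⬝ᵥ (C *ᵥ f' j) = (if (i : ℕ) = j then √(ν i ^ 2 - 1) else 0) ∧
      e i ⬝ᵥ (C *ᵥ f' j) = 0 ∧ f i ⬝ᵥ (C *ᵥ e' j) = 0 := by
    intro i j
    simp only [hC]
    by_cases hi : (i : ℕ) < k
    · obtain ⟨hf, he, -⟩ := hag' i ⟨i, hi.trans_le hkM⟩ hi rfl
      rw [hf, he]
      simp only [neg_dotProduct, smul_dotProduct, Omega_mulVec_dotProduct,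
        hw'.ee _ (Finset.mem_univ _) _ (Finset.mem_univ _),
        hw'.ff _ (Finset.mem_univ _) _ (Finset.mem_univ _),
        hw'.ef _ (Finset.mem_univ _) _ (Finset.mem_univ _)]
      rw [dotProduct_Omega_swap, hw'.ef _ (Finset.mem_univ _) _ (Finset.mem_univ _)]
      simp only [Fin.ext_iff, eq_comm (a := (j : ℕ))]
      split_ifs <;> simp
    · have h1 := hν1' i (not_lt.1 hi)
      rw [h.left_eq_zero hw (Finset.mem_univ _) h1, h.right_eq_zero hw (Finset.mem_univ _) h1, h1]
      simp
  -- For `j ≥ k` the vector `C (e' j)` is orthogonal to the whole basis `e`, `f`, hence zero.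
  have hμ1 : ∀ j : Fin M, k ≤ j → μ j = 1 := by
    intro j hj
    refine h.eigenvalue_eq_one hw' (Finset.mem_univ j) (hw.eq_zero_of_dotProduct ?_ ?_)
    · intro i
      rw [(hentries i j).1]
      split_ifs with hij
      · rw [hν1' i (hij ▸ hj)]
        simp
      · rfl
    · intro i
      exact (hentries i j).2.2.2
  refine ⟨e, f, ν, e', f', μ, hw, hw', hν1, fun i hi => hν1' i (hkM.trans hi),
    fun j hj => hμ1 j (hkN.trans hj), fun i j hij => ?_, fun i j => (hentries i j).1,
    fun i j => (hentries i j).2.1, fun i j => (hentries i j).2.2.1,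
    fun i j => (hentries i j).2.2.2⟩
  by_cases hi : (i : ℕ) < k
  · exact (hag' i j hi hij).2.2
  · rw [hν1' i (not_lt.1 hi), hμ1 j (hij ▸ not_lt.1 hi)]

end NormalForm

/-! ### Splitting phase space into data and ancilla -/

section Blocks

variable {α β : Type}

lemma fromBlocks_Omega_submatrix [DecidableEq α] [DecidableEq β] :
    (Omega (α ⊕ β)).submatrix (Equiv.sumSumSumComm α α β β) (Equiv.sumSumSumComm α α β β) =
      Matrix.fromBlocks (Omega α) 0 0 (Omega β) := by
  ext ((i | i) | (i | i)) ((j | j) | (j | j)) <;>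
    simp [Omega, Matrix.one_apply]

variable [Fintype α] [Fintype β]

lemma dataPart_localSum (A : Matrix (Quad α) (Quad α) ℝ) (B : Matrix (Quad β) (Quad β) ℝ)
    (x : Phase (α ⊕ β)) : dataPart (localSum A B *ᵥ x) = A *ᵥ dataPart x := by
  ext (i | i) <;>
  simp [dataPart, localSum, Matrix.mulVec, dotProduct, Fintype.sum_sum_type]

lemma ancillaPart_localSum (A : Matrix (Quad α) (Quad α) ℝ) (B : Matrix (Quad β) (Quad β) ℝ)
    (x : Phase (α ⊕ β)) : ancillaPart (localSum A B *ᵥ x) = B *ᵥ ancillaPart x := by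
  ext (i | i) <;>
  simp [ancillaPart, localSum, Matrix.mulVec, dotProduct, Fintype.sum_sum_type]

variable [DecidableEq α] [DecidableEq β]

/-- The blocks of a positive definite symplectic matrix form a pure state. -/
lemma exists_isPure_of_posDef_symplectic (P : Matrix (Quad (α ⊕ β)) (Quad (α ⊕ β)) ℝ)
    (hP : P.PosDef) (hS : P ∈ Sp (α ⊕ β)) : ∃ A C B, IsPure A C B ∧
      P = (Matrix.fromBlocks A C Cᵀ B).reindex
        (Equiv.sumSumSumComm α α β β) (Equiv.sumSumSumComm α α β β) := by
  set E := Equiv.sumSumSumComm α α β β with hE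
  set Q := P.submatrix E E with hQdef
  have hQ : Q.PosDef := hP.submatrix E.injective
  have hsymm : Qᵀ = Q := by simpa using hQ.isHermitian.eq
  -- As `P` is symmetric, being symplectic reads `PΩP = Ω`; the blocks of this identity are the
  -- purity relations.
  have hΩ : Q * Matrix.fromBlocks (Omega α) 0 0 (Omega β) * Q =
      Matrix.fromBlocks (Omega α) 0 0 (Omega β) := by
    rw [mem_Sp_iff] at hS
    have hPs : Pᵀ = P := by simpa using hP.isHermitian.eq
    rw [hPs] at hS
    rw [← fromBlocks_Omega_submatrix, hQdef, ← hE, Matrix.submatrix_mul_equiv,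
      Matrix.submatrix_mul_equiv, hS]
  have hblocks : Q = Matrix.fromBlocks Q.toBlocks₁₁ Q.toBlocks₁₂ Q.toBlocks₁₂ᵀ Q.toBlocks₂₂ := by
    have h21 : Q.toBlocks₂₁ = Q.toBlocks₁₂ᵀ := by
      ext i j
      exact congrFun (congrFun hsymm (Sum.inl j)) (Sum.inr i)
    rw [← h21, Matrix.fromBlocks_toBlocks]
  refine ⟨Q.toBlocks₁₁, Q.toBlocks₁₂, Q.toBlocks₂₂, ?_, ?_⟩
  · have hA : Q.toBlocks₁₁.PosDef := hQ.submatrix (e := Sum.inl) Sum.inl_injective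
    have hB : Q.toBlocks₂₂.PosDef := hQ.submatrix (e := Sum.inr) Sum.inr_injective
    generalize Q.toBlocks₁₁ = A at hblocks hA
    generalize Q.toBlocks₁₂ = C at hblocks
    generalize Q.toBlocks₂₂ = B at hblocks hB
    rw [hblocks] at hΩ
    simp only [Matrix.fromBlocks_multiply, Matrix.mul_zero, add_zero, zero_add,
      Matrix.fromBlocks_inj] at hΩ
    exact ⟨hA, hB, hΩ.1, hΩ.2.2.1, hΩ.2.2.2⟩
  · rw [← hblocks, hQdef]
    ext i j
    simp

end Blocks

/-! ### Products of two-mode squeezers -/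

section TMS

variable {N M : ℕ} {G : Fin (min N M) → ℝ}

lemma one_le_gainAt (hG : ∀ i, 1 ≤ G i) (k : ℕ) : 1 ≤ gainAt G k := by
  unfold gainAt
  split_ifs
  · exact hG _
  · exact le_rfl

lemma gainAt_of_le {k : ℕ} (hk : min N M ≤ k) : gainAt G k = 1 := dif_neg (not_lt.2 hk)

lemma tmsCoupling_mul_transpose (hG : ∀ i, 1 ≤ G i) :
    tmsCoupling G * (tmsCoupling G)ᵀ = Matrix.diagonal fun i : Fin N => gainAt G i - 1 := by
  ext i i'
  rw [Matrix.mul_apply]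
  simp only [tmsCoupling, Matrix.transpose_apply, Matrix.of_apply]
  by_cases hii : i = i'
  · subst hii
    rw [Matrix.diagonal_apply_eq]
    by_cases hi : (i : ℕ) < M
    · rw [Finset.sum_eq_single ⟨i, hi⟩]
      · simpa using Real.mul_self_sqrt (sub_nonneg.2 (one_le_gainAt hG i))
      · intro j _ hj
        rw [if_neg fun h => hj (Fin.ext h.symm), zero_mul]
      · simp
    -- A mode without partner has a zero row, matching `G - 1 = 0`.
    · rw [gainAt_of_le ((min_le_right _ _).trans (not_lt.1 hi))]
      simp
  · rw [Matrix.diagonal_apply_ne _ hii]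
    refine Finset.sum_eq_zero fun j _ => ?_
    split_ifs with h1 h2
    · exact absurd (Fin.ext (h1.trans h2.symm)) hii
    all_goals simp

lemma transpose_mul_tmsCoupling (hG : ∀ i, 1 ≤ G i) :
    (tmsCoupling G)ᵀ * tmsCoupling G = Matrix.diagonal fun j : Fin M => gainAt G j - 1 := by
  ext j j'
  rw [Matrix.mul_apply]
  simp only [tmsCoupling, Matrix.transpose_apply, Matrix.of_apply]
  by_cases hjj : j = j'
  · subst hjj
    rw [Matrix.diagonal_apply_eq]
    by_cases hj : (j : ℕ) < N
    · rw [Finset.sum_eq_single ⟨j, hj⟩]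
      · simpa using Real.mul_self_sqrt (sub_nonneg.2 (one_le_gainAt hG j))
      · intro i _ hi
        rw [if_neg fun h => hi (Fin.ext h), zero_mul]
      · simp
    · rw [gainAt_of_le ((min_le_left _ _).trans (not_lt.1 hj))]
      have : ∀ i : Fin N, (i : ℕ) ≠ j := fun i h => hj (h ▸ i.2)
      simp [this]
  · rw [Matrix.diagonal_apply_ne _ hjj]
    refine Finset.sum_eq_zero fun i _ => ?_
    split_ifs with h1 h2
    · exact absurd (Fin.ext (h1.symm.trans h2)) hjj
    all_goals simp

/-- Opposite signs give the inverse, from `G - (G - 1) = 1`; equal signs give the covariance matrix,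
with diagonal `2G - 1`. -/
lemma tmsQuad_mul_tmsQuad (hG : ∀ i, 1 ≤ G i) (s t : ℝ) :
    tmsQuad s G * tmsQuad t G = Matrix.fromBlocks
      (Matrix.diagonal fun i : Fin N => gainAt G i + s * t * (gainAt G i - 1))
      (Matrix.of fun (i : Fin N) (j : Fin M) => if (i : ℕ) = j then
        (s + t) * (√(gainAt G i) * √(gainAt G i - 1)) else 0)
      (Matrix.of fun (j : Fin M) (i : Fin N) => if (i : ℕ) = j then
        (s + t) * (√(gainAt G i) * √(gainAt G i - 1)) else 0)
      (Matrix.diagonal fun j : Fin M => gainAt G j + s * t * (gainAt G j - 1)) := by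
  have hd : ∀ k : ℕ, √(gainAt G k) * √(gainAt G k) = gainAt G k := fun k =>
    Real.mul_self_sqrt (zero_le_one.trans (one_le_gainAt hG k))
  rw [tmsQuad, tmsQuad, Matrix.fromBlocks_multiply]
  simp only [Matrix.diagonal_mul_diagonal, hd, Matrix.smul_mul, Matrix.mul_smul,
    tmsCoupling_mul_transpose hG, transpose_mul_tmsCoupling hG]
  congr 1
  · ext i j
    by_cases hij : i = j
    · subst hij
      simp
      ring
    · simp [hij]
  · ext i j
    simp only [tmsCoupling, Matrix.add_apply, Matrix.smul_apply, Matrix.diagonal_mul,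
      Matrix.mul_diagonal, Matrix.of_apply, smul_eq_mul]
    split_ifs with h
    · rw [h]
      ring
    · simp
  · ext j i
    simp only [tmsCoupling, Matrix.add_apply, Matrix.smul_apply, Matrix.diagonal_mul,
      Matrix.mul_diagonal, Matrix.of_apply, smul_eq_mul, Matrix.transpose_apply]
    split_ifs with h
    · rw [h]
      ring
    · simp
  · ext i j
    by_cases hij : i = j
    · subst hij
      simp
      ring
    · simp [hij]

lemma tmsQuad_mul_neg (hG : ∀ i, 1 ≤ G i) {s t : ℝ} (hst : s + t = 0) (hst' : s * t = -1) :
    tmsQuad s G * tmsQuad t G = 1 := by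
  rw [tmsQuad_mul_tmsQuad hG, hst, hst', ← Matrix.fromBlocks_one]
  congr 1
  · ext i j
    by_cases h : i = j
    · subst h
      simp
    · simp [h]
  · ext i j
    simp
  · ext i j
    simp
  · ext i j
    by_cases h : i = j
    · subst h
      simp
    · simp [h]

lemma tmsQuad_transpose (s : ℝ) : (tmsQuad s G)ᵀ = tmsQuad s G := by
  simp [tmsQuad, Matrix.fromBlocks_transpose]

/-- Positions and momenta are transformed by symmetric, mutually inverse matrices. -/
lemma tmsMatrix_mem (hG : ∀ i, 1 ≤ G i) : tmsMatrix G ∈ Sp (Fin N ⊕ Fin M) := by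
  rw [mem_Sp_iff]
  simp [tmsMatrix, Omega, Matrix.fromBlocks_transpose, Matrix.fromBlocks_multiply,
    tmsQuad_transpose, tmsQuad_mul_neg hG]

lemma tmsMatrix_inv (hG : ∀ i, 1 ≤ G i) :
    (tmsMatrix G)⁻¹ = Matrix.fromBlocks (tmsQuad (-1) G) 0 0 (tmsQuad 1 G) := by
  apply Matrix.inv_eq_right_inv
  simp [tmsMatrix, Matrix.fromBlocks_multiply, tmsQuad_mul_neg hG]

end TMS

/-! ### Reduction to two-mode squeezed covariance matrices -/

section Reduction

variable {N M : ℕ}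

lemma IsWilliamson.rowMatrix_mul_mul_transpose_self {α : Type} [DecidableEq α] [Fintype α]
    {A : Matrix (Quad α) (Quad α) ℝ} {e f : α → Phase α} {ν : α → ℝ}
    (h : IsWilliamson A Finset.univ e f ν) :
    rowMatrix e f * A * (rowMatrix e f)ᵀ =
      Matrix.fromBlocks (Matrix.diagonal ν) 0 0 (Matrix.diagonal ν) := by
  rw [rowMatrix_mul_mul_transpose]
  have hu : ∀ i : α, i ∈ Finset.univ := Finset.mem_univ
  congr 1 <;> ext i j <;>
    simp only [Matrix.of_apply, h.left j (hu j), h.right j (hu j), dotProduct_neg,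
      dotProduct_smul, h.ee i (hu i) j (hu j), h.ff i (hu i) j (hu j), h.ef i (hu i) j (hu j),
      smul_eq_mul]
  · by_cases hij : i = j <;> simp [hij]
  · simp
  · simp
  · rw [dotProduct_Omega_swap, h.ef j (hu j) i (hu i), Matrix.diagonal_apply]
    split_ifs <;> simp_all

/-- Up to local symplectic transformations, every pure Gaussian state of two groups of modes is a
product of two-mode squeezed states. -/
lemma exists_local_reduction (P : Matrix (Quad (Fin N ⊕ Fin M)) (Quad (Fin N ⊕ Fin M)) ℝ)
    (hP : P.PosDef) (hS : P ∈ Sp (Fin N ⊕ Fin M)) :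
    ∃ (G : Fin (min N M) → ℝ) (Λd : Sp (Fin N)) (Λa : Sp (Fin M)), (∀ i, 1 ≤ G i) ∧
      localSum Λd.1 Λa.1 * P * (localSum Λd.1 Λa.1)ᵀ =
        (tmsMatrix G)⁻¹ * ((tmsMatrix G)⁻¹)ᵀ := by
  obtain ⟨A, C, B, hpure, rfl⟩ := exists_isPure_of_posDef_symplectic P hP hS
  obtain ⟨e, f, ν, e', f', μ, hw, hw', hν1, hνM, hμN, hμν, hee, hff, hef, hfe⟩ :=
    hpure.exists_normal_form
  -- Solves `2G - 1 = ν`; then `ν² - 1 = 4G(G - 1)` matches the correlations too.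
  let G : Fin (min N M) → ℝ := fun i => (ν (Fin.castLE (min_le_left _ _) i) + 1) / 2
  have hG : ∀ i, 1 ≤ G i := fun i => by
    have := hν1 (Fin.castLE (min_le_left _ _) i)
    simp only [G]
    linarith
  have hgain : ∀ i : Fin N, gainAt G i = (ν i + 1) / 2 := by
    intro i
    by_cases hi : (i : ℕ) < min N M
    · rw [gainAt, dif_pos hi]
      rfl
    · rw [gainAt, dif_neg hi, hνM i (by have := i.2; omega)]
      norm_num
  have hgain' : ∀ j : Fin M, gainAt G j = (μ j + 1) / 2 := by
    intro j
    by_cases hj : (j : ℕ) < N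
    · rw [hμν ⟨j, hj⟩ j rfl, ← hgain ⟨j, hj⟩]
    · rw [gainAt, dif_neg (by omega), hμN j (not_lt.1 hj)]
      norm_num
  have hsqrt : ∀ i : Fin N, √(ν i ^ 2 - 1) = 2 * (√(gainAt G i) * √(gainAt G i - 1)) := by
    intro i
    have := hν1 i
    rw [← Real.sqrt_mul (by rw [hgain]; linarith), hgain,
      show ν i ^ 2 - 1 = 2 ^ 2 * ((ν i + 1) / 2 * ((ν i + 1) / 2 - 1)) by ring,
      Real.sqrt_mul (by norm_num), Real.sqrt_sq (by norm_num)]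
  refine ⟨G, ⟨_, hw.rowMatrix_mem⟩, ⟨_, hw'.rowMatrix_mem⟩, hG, ?_⟩
  have hC := rowMatrix_mul_mul_transpose e f e' f' C
  have hCt := congrArg Matrix.transpose hC
  rw [Matrix.transpose_mul, Matrix.transpose_mul, Matrix.transpose_transpose, ← Matrix.mul_assoc]
    at hCt
  rw [tmsMatrix_inv hG, Matrix.fromBlocks_transpose, tmsQuad_transpose, tmsQuad_transpose,
    Matrix.fromBlocks_multiply]
  simp only [Matrix.transpose_zero, Matrix.mul_zero, Matrix.zero_mul, add_zero, zero_add,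
    tmsQuad_mul_tmsQuad hG]
  simp only [localSum, Matrix.reindex_apply, Matrix.transpose_submatrix,
    Matrix.submatrix_mul_equiv, Matrix.fromBlocks_transpose, Matrix.fromBlocks_multiply,
    Matrix.transpose_zero, Matrix.mul_zero, Matrix.zero_mul, add_zero, zero_add,
    hw.rowMatrix_mul_mul_transpose_self, hw'.rowMatrix_mul_mul_transpose_self, hC, hCt]
  have hνg : ∀ i : Fin N, gainAt G i + (gainAt G i - 1) = ν i := fun i => by rw [hgain]; ring
  have hμg : ∀ j : Fin M, gainAt G j + (gainAt G j - 1) = μ j := fun j => by rw [hgain']; ring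
  ext ((i | i) | (i | i)) ((j | j) | (j | j)) <;>
    simp [hee, hff, hef, hfe, hνg, hμg, hsqrt, Matrix.diagonal_apply]
  all_goals split_ifs <;> ring

end Reduction

/-! ### Syndromes, residual displacements and the transformed code -/

section Decoding

variable {N M : ℕ}

lemma measurable_modEll : Measurable modEll := by
  unfold modEll
  simp_rw [round_eq]
  fun_prop

lemma measurable_syndrome (L : Lattice M) : Measurable L.syndrome := by
  refine measurable_pi_lambda _ fun k => measurable_modEll.comp ?_
  exact Continuous.measurable (by fun_prop)

lemma measurable_dataPart {α β : Type} : Measurable (dataPart (α := α) (β := β)) := by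
  refine measurable_pi_lambda _ fun k => ?_
  rcases k with k | k <;> exact measurable_pi_apply _

lemma measurable_ancillaPart {α β : Type} : Measurable (ancillaPart (α := α) (β := β)) := by
  refine measurable_pi_lambda _ fun k => ?_
  rcases k with k | k <;> exact measurable_pi_apply _

lemma measurable_decoded (S : Sp (Fin N ⊕ Fin M)) : Measurable (decoded S) :=
  measurable_mulVec _

/-- The residual displacement as a function of the displacements of the data and the ancilla. -/
noncomputable def correct (L : Lattice M) (f : Phase (Fin M) → Phase (Fin N))
    (x : Phase (Fin N ⊕ Fin M)) : Phase (Fin N) :=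
  dataPart x - f (L.syndrome (ancillaPart x))

lemma measurable_correct (L : Lattice M) {f : Phase (Fin M) → Phase (Fin N)} (hf : Measurable f) :
    Measurable (correct L f) :=
  measurable_dataPart.sub (hf.comp ((measurable_syndrome L).comp measurable_ancillaPart))

lemma residualLaw_eq_map (S : Sp (Fin N ⊕ Fin M)) (L : Lattice M) (σ : ℝ≥0)
    {f : Phase (Fin M) → Phase (Fin N)} (hf : Measurable f) :
    residualLaw S L σ f = (decodedNoise S σ).map (correct L f) := by
  rw [decodedNoise, Measure.map_map (measurable_correct L hf) (measurable_decoded S)]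
  rfl

lemma isProbabilityMeasure_residualLaw (S : Sp (Fin N ⊕ Fin M)) (L : Lattice M) (σ : ℝ≥0)
    {f : Phase (Fin M) → Phase (Fin N)} (hf : Measurable f) :
    IsProbabilityMeasure (residualLaw S L σ f) := by
  have : IsProbabilityMeasure (agn N M σ) := by
    unfold agn
    infer_instance
  exact Measure.isProbabilityMeasure_map
    ((measurable_correct L hf).comp (measurable_decoded S)).aemeasurable

/-- The image of a lattice under a symplectic transformation. -/
def Lattice.image (L : Lattice M) (Λ : Sp (Fin M)) : Lattice M where
  gen := Λ.1 * L.gen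
  isUnit_det := by
    rw [Matrix.det_mul]
    exact (SymplecticGroup.symplectic_det Λ.2).mul L.isUnit_det
  integral := by
    obtain ⟨A, hA⟩ := L.integral
    refine ⟨A, ?_⟩
    rw [← hA, Matrix.transpose_mul]
    conv_rhs => rw [← (mem_Sp_iff' Λ.1).1 Λ.2]
    simp only [Matrix.mul_assoc]

lemma Lattice.image_points (L : Lattice M) (Λ : Sp (Fin M)) :
    ((L.image Λ).points : Set (Phase (Fin M))) = (fun v => Λ.1 *ᵥ v) '' L.points := by
  let F : Phase (Fin M) →ₗ[ℤ] Phase (Fin M) := Λ.1.mulVecLin.restrictScalars ℤ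
  have : (L.image Λ).points = L.points.map F := by
    rw [Lattice.points, Lattice.points, Submodule.map_span, ← Set.range_comp]
    rfl
  rw [this]
  rfl

lemma Lattice.image_isCanonical_iff (L : Lattice M) (Λ : Sp (Fin M)) :
    (L.image Λ).IsCanonical ↔ L.IsCanonical := by
  simp [Lattice.IsCanonical, Lattice.image, SymplecticGroup.det_eq_one Λ.2]

/-- `ΛᵀΩΛ = Ω`, so the symplectic products agree even before reduction modulo `ℓ`. -/
lemma Lattice.syndrome_image (L : Lattice M) (Λ : Sp (Fin M)) (x : Phase (Fin M)) :
    (L.image Λ).syndrome (Λ.1 *ᵥ x) = L.syndrome x := by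
  have h : (L.image Λ).genᵀ *ᵥ (Omega (Fin M) *ᵥ (Λ.1 *ᵥ x)) =
      L.genᵀ *ᵥ (Omega (Fin M) *ᵥ x) := by
    simp only [Lattice.image, Matrix.mulVec_mulVec, Matrix.transpose_mul]
    conv_rhs => rw [← (mem_Sp_iff' Λ.1).1 Λ.2]
    simp only [Matrix.mul_assoc]
  unfold Lattice.syndrome
  rw [h]

lemma correct_image (L : Lattice M) (Λd : Sp (Fin N)) (Λa : Sp (Fin M))
    (f : Phase (Fin M) → Phase (Fin N)) (x : Phase (Fin N ⊕ Fin M)) :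
    correct (L.image Λa) (fun s => Λd.1 *ᵥ f s) (localSum Λd.1 Λa.1 *ᵥ x) =
      Λd.1 *ᵥ correct L f x := by
  rw [correct, dataPart_localSum, ancillaPart_localSum, Lattice.syndrome_image, correct,
    Matrix.mulVec_sub]

/-- The residual law sees the encoding only through the law of the decoded noise, and
`correct_image` is a pointwise identity. -/
lemma residualLaw_image {S T : Sp (Fin N ⊕ Fin M)} {Λd : Sp (Fin N)} {Λa : Sp (Fin M)} {σ : ℝ≥0}
    (h : (decodedNoise S σ).map (fun x => localSum Λd.1 Λa.1 *ᵥ x) = decodedNoise T σ)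
    (L : Lattice M) {f : Phase (Fin M) → Phase (Fin N)} (hf : Measurable f) :
    residualLaw T (L.image Λa) σ (fun s => Λd.1 *ᵥ f s) =
      (residualLaw S L σ f).map (fun x => Λd.1 *ᵥ x) := by
  have hf' : Measurable fun s => Λd.1 *ᵥ f s := (measurable_mulVec Λd.1).comp hf
  rw [residualLaw_eq_map S L σ hf, residualLaw_eq_map T _ σ hf', ← h,
    Measure.map_map (measurable_correct _ hf') (measurable_mulVec _),
    Measure.map_map (measurable_mulVec _) (measurable_correct L hf)]
  congr 1
  ext1 x
  exact correct_image L Λd Λa f x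

/-- Up to local symplectic transformations, every encoding turns iid Gaussian noise into the same
noise as a product of two-mode squeezers. -/
lemma exists_tms_decodedNoise (S : Sp (Fin N ⊕ Fin M)) :
    ∃ (G : Fin (min N M) → ℝ) (T : Sp (Fin N ⊕ Fin M)) (Λd : Sp (Fin N)) (Λa : Sp (Fin M)),
      (∀ i, 1 ≤ G i) ∧ T.1 = tmsMatrix G ∧ ∀ σ : ℝ≥0,
        (decodedNoise S σ).map (fun x => localSum Λd.1 Λa.1 *ᵥ x) = decodedNoise T σ := by
  have hinv : S.1⁻¹ ∈ Sp (Fin N ⊕ Fin M) := by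
    rw [← SymplecticGroup.coe_inv']
    exact (S⁻¹).2
  -- The covariance matrix of the decoded noise at unit variance; independent of `σ`, so one
  -- reduction serves every noise level.
  have hP : (S.1⁻¹ * (S.1⁻¹)ᵀ).PosDef := by
    have := Matrix.PosDef.mul_conjTranspose_self (S.1⁻¹)
      (Matrix.vecMul_injective_of_isUnit
        ((Matrix.isUnit_iff_isUnit_det _).2 (SymplecticGroup.symplectic_det hinv)))
    simpa using this
  obtain ⟨G, Λd, Λa, hG, h⟩ := exists_local_reduction _ hP
    (mul_mem hinv (SymplecticGroup.transpose_mem hinv))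
  refine ⟨G, ⟨_, tmsMatrix_mem hG⟩, Λd, Λa, hG, rfl, fun σ => ?_⟩
  have hcomp : (fun x => localSum Λd.1 Λa.1 *ᵥ x) ∘ decoded S =
      fun x => (localSum Λd.1 Λa.1 * S.1⁻¹) *ᵥ x := by
    ext1 x
    simp only [Function.comp_apply, decoded, Matrix.mulVec_mulVec]
  rw [decodedNoise, Measure.map_map (measurable_mulVec _) (measurable_decoded S), hcomp]
  refine map_mulVec_gaussian_eq _ ?_
  rw [← h, Matrix.transpose_mul]
  simp only [Matrix.mul_assoc]

end Decoding

end GKP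

theorem theorem1 (N M : ℕ) (S : GKP.Sp (Fin N ⊕ Fin M)) :
    ∃ (G : Fin (min N M) → ℝ) (T : GKP.Sp (Fin N ⊕ Fin M))
      (Λd : GKP.Sp (Fin N)) (Λa : GKP.Sp (Fin M)),
      -- the new encoding is a direct product of two-mode squeezers
      (∀ i, 1 ≤ G i) ∧ T.1 = GKP.tmsMatrix G ∧
      -- up to the local symplectic maps, both encodings turn the noise into the same noise
      (∀ σ : ℝ≥0, (GKP.decodedNoise S σ).map (fun x => GKP.localSum Λd.1 Λa.1 *ᵥ x) =
        GKP.decodedNoise T σ) ∧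
      -- every ancillary lattice is replaced by its symplectic image, which is again a lattice
      ∀ L : GKP.Lattice M, ∃ L' : GKP.Lattice M,
        L'.gen = Λa.1 * L.gen ∧
        (L'.points : Set (GKP.Phase (Fin M))) = (fun v => Λa.1 *ᵥ v) '' L.points ∧
        (L'.IsCanonical ↔ L.IsCanonical) ∧
        -- every estimator `f` corresponds to the estimator `Λd f` of the reduced code
        ∀ (σ : ℝ≥0) (f : GKP.Phase (Fin M) → GKP.Phase (Fin N)), Measurable f →
          GKP.residualLaw T L' σ (fun s => Λd.1 *ᵥ f s) =
            (GKP.residualLaw S L σ f).map (fun x => Λd.1 *ᵥ x) ∧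
          (GKP.FiniteVariance (GKP.residualLaw S L σ f) →
            GKP.FiniteVariance (GKP.residualLaw T L' σ (fun s => Λd.1 *ᵥ f s)) ∧
            GKP.covMatrix (GKP.residualLaw T L' σ (fun s => Λd.1 *ᵥ f s)) =
              Λd.1 * GKP.covMatrix (GKP.residualLaw S L σ f) * Λd.1ᵀ ∧
            GKP.gmError (GKP.covMatrix (GKP.residualLaw T L' σ (fun s => Λd.1 *ᵥ f s))) =
              GKP.gmError (GKP.covMatrix (GKP.residualLaw S L σ f)) ∧
            GKP.momentMatrix (GKP.residualLaw T L' σ (fun s => Λd.1 *ᵥ f s)) =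
              Λd.1 * GKP.momentMatrix (GKP.residualLaw S L σ f) * Λd.1ᵀ ∧
            GKP.gmError (GKP.momentMatrix (GKP.residualLaw T L' σ (fun s => Λd.1 *ᵥ f s))) =
              GKP.gmError (GKP.momentMatrix (GKP.residualLaw S L σ f))) := by
  obtain ⟨G, T, Λd, Λa, hG, hT, hnoise⟩ := GKP.exists_tms_decodedNoise S
  refine ⟨G, T, Λd, Λa, hG, hT, hnoise, fun L => ⟨L.image Λa, rfl, L.image_points Λa,
    L.image_isCanonical_iff Λa, fun σ f hf => ?_⟩⟩
  have hlaw := GKP.residualLaw_image (hnoise σ) L hf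
  refine ⟨hlaw, fun hfin => ?_⟩
  have := GKP.isProbabilityMeasure_residualLaw S L σ hf
  have hcov := GKP.covMatrix_map_mulVec Λd.1 hfin
  have hmom := GKP.momentMatrix_map_mulVec Λd.1 hfin
  rw [hlaw]
  refine ⟨hfin.map_mulVec _, hcov, ?_, hmom, ?_⟩
  · rw [hcov, GKP.gmError_symplectic_conj _ _ Λd.2]
  · rw [hmom, GKP.gmError_symplectic_conj _ _ Λd.2]
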